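/- Let $p\ge 3$ be a prime and let $\mathbb{F}_p$ be the $p$-element field. A \emph{direction} in the affine plane $\mathbb{F}_p^2$ is a pencil of $p$ parallel lines, so that there are $p+1$ directions. A set $S\subseteq\mathbb{F}_p^2$ \emph{determines} a direction if some line in this direction contains at least two points of $S$. A direction is \emph{perfect} with respect to a function $w\colon\mathbb{F}_p^2\to\mathbb{R}$ if $\sum_{z\in l}w(z)=\frac1p\sum_{z\in\mathbb{F}_p^2}w(z)$ for every line $l$ in this direction. Let $S\subseteq\mathbb{F}_p^2$ be a set with $|S|=p$. Then every direction not determined by $S$ is perfect with respect to the indicator function of $S$. Moreover, if $S$ is not a line, then at most $\frac{p-1}{2}$ directions are not determined by $S$, and $S$ determines at least $\frac{p+3}{2}$ directions. -/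

import Mathlib

namespace FinitePlane

/-- The affine plane over the field with `p` elements. -/
abbrev Plane (p : ℕ) : Type := Fin 2 → ZMod p

/-- A line of the plane: a nonempty affine subspace of dimension one. -/
def IsLine {p : ℕ} [Fact p.Prime] (l : AffineSubspace (ZMod p) (Plane p)) : Prop :=
  (l : Set (Plane p)).Nonempty ∧ Module.finrank (ZMod p) l.direction = 1

/-- A direction is a pencil of parallel lines: all lines parallel to some given line. -/
def IsDirection {p : ℕ} [Fact p.Prime] (d : Set (AffineSubspace (ZMod p) (Plane p))) : Prop :=
  ∃ l, IsLine l ∧ d = {m | IsLine m ∧ m.Parallel l}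

/-- `S` determines the direction `d` if a line of `d` contains at least two points of `S`. -/
def Determines {p : ℕ} (S : Set (Plane p)) (d : Set (AffineSubspace (ZMod p) (Plane p))) :
    Prop :=
  ∃ l ∈ d, ∃ x ∈ S, ∃ y ∈ S, x ≠ y ∧ x ∈ l ∧ y ∈ l

/-- The direction `d` is perfect with respect to the weight `w` if every line of `d` carries
exactly the share `1 / p` of the total mass of `w`. -/
def IsPerfect {p : ℕ} [Fact p.Prime] (w : Plane p → ℝ)
    (d : Set (AffineSubspace (ZMod p) (Plane p))) : Prop :=
  ∀ l ∈ d, ∑ z : Plane p, (l : Set (Plane p)).indicator w z = (1 / (p : ℝ)) * ∑ z : Plane p, w z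

end FinitePlane

/-! A linear form whose kernel is an undetermined direction is injective on the $p$ points of $S$,
hence bijective: each line of that direction meets $S$ exactly once, which gives perfection. For the
bound, make one undetermined direction vertical, so that $S$ is the graph of some $f$. A slope $m$
is undetermined iff $f(x)-mx$ is a permutation, and then its $k$-th power sum vanishes for $0\le
k<p-1$. With $(p-1)/2$ such slopes, all moments $\sum x^j f(x)^{k-j}$ with $k\le(p-1)/2$ vanish
(`ZMod.moment_eq_zero`). If $f$ had degree $d\ge2$, dividing $p-1=qd+r$ would make $x^r f^q$ of
degree exactly $p-1$, so its sum would be nonzero, although $q+r\le(p-1)/2$. Hence $f$ is affine and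
$S$ is a line. -/

/-! ### Power sums over the prime field -/

open Polynomial Finset in
theorem ZMod.sum_eval_eq_neg_coeff {p : ℕ} [Fact p.Prime] (P : (ZMod p)[X])
    (hP : P.natDegree ≤ p - 1) : ∑ x : ZMod p, P.eval x = -P.coeff (p - 1) := by
  have hp := (Fact.out : p.Prime).two_le
  have hpow : ∑ x : ZMod p, x ^ (p - 1) = -1 := by
    have h (x : ZMod p) : x ^ (p - 1) = 1 - if x = 0 then 1 else 0 := by
      split_ifs with hx
      · rw [hx, zero_pow (by omega), sub_self]
      · rw [ZMod.pow_card_sub_one_eq_one hx, sub_zero]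
    simp [h]
  simp_rw [eval_eq_sum_range' (n := p - 1 + 1) (Nat.lt_succ_of_le hP)]
  rw [sum_comm, sum_range_succ]
  simp_rw [← mul_sum]
  rw [hpow, sum_eq_zero, zero_add, mul_neg_one]
  intro i hi
  rw [FiniteField.sum_pow_lt_card_sub_one, mul_zero]
  simpa [ZMod.card] using hi

-- The $k$-th power sum of $f(x)-mx$ is a polynomial in $m$ whose coefficients are the moments up to
-- signs and binomials.
open Polynomial Finset in
theorem ZMod.moment_eq_zero {p : ℕ} [Fact p.Prime] {f : ZMod p → ZMod p} {M : Finset (ZMod p)}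
    (hM : ∀ m ∈ M, Function.Injective fun x => f x - m * x) {k : ℕ} (hk : k ≤ #M)
    (hkp : k < p - 1) {j : ℕ} (hj : j ≤ k) : ∑ x, x ^ j * f x ^ (k - j) = 0 := by
  have hpow : ∑ x : ZMod p, x ^ k = 0 :=
    FiniteField.sum_pow_lt_card_sub_one _ _ (by simpa [ZMod.card] using hkp)
  obtain rfl | hjk := hj.eq_or_lt
  · simpa using hpow
  let c (i : ℕ) : ZMod p := (-1) ^ i * (∑ x, x ^ i * f x ^ (k - i)) * k.choose i
  -- The $m^k$ term is left out because $\sum x^k=0$; so the degree is below $k\le|M|$, and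
  -- vanishing on $M$ forces `G = 0`.
  let G : (ZMod p)[X] := ∑ i ∈ range k, C (c i) * X ^ i
  have hcoeff (i : ℕ) : G.coeff i = if i < k then c i else 0 := by
    simp [G, coeff_X_pow]
  have hG : G = 0 := by
    apply eq_zero_of_degree_lt_of_eval_finset_eq_zero M
    · rw [degree_lt_iff_coeff_zero]
      intro i hi
      rw [hcoeff, if_neg (by omega)]
    · intro m hm
      have hbij := (Finite.injective_iff_bijective).1 (hM m hm)
      have h := (hbij.sum_comp fun y => y ^ k).trans hpow
      have h2 (x : ZMod p) : (f x - m * x) ^ k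
          = ∑ i ∈ range (k + 1), (-(m * x)) ^ i * f x ^ (k - i) * k.choose i := by
        rw [← add_pow]; ring
      simp_rw [h2] at h
      rw [sum_comm, sum_range_succ] at h
      have htop : ∑ x, (-(m * x)) ^ k * f x ^ (k - k) * (k.choose k : ZMod p) = 0 := by
        simp only [Nat.sub_self, pow_zero, mul_one, Nat.choose_self, Nat.cast_one, ← neg_mul,
          mul_pow, ← mul_sum, hpow, mul_zero]
      rw [htop, add_zero] at h
      rw [← h]
      simp only [G, c, eval_finsetSum, eval_mul, eval_C, eval_pow, eval_X]
      refine sum_congr rfl fun i _ => ?_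
      simp only [mul_sum, sum_mul]
      refine sum_congr rfl fun x _ => ?_
      rw [neg_pow (m * x), mul_pow]
      ring
  have hc : c j = 0 := by simpa [hG, hjk] using (hcoeff j).symm
  have hchoose : (k.choose j : ZMod p) ≠ 0 := by
    rw [Ne, ZMod.natCast_eq_zero_iff]
    intro hdvd
    have := ((Fact.out : p.Prime).dvd_factorial).1
      (hdvd.trans (Dvd.intro _ ((mul_assoc _ _ _).symm.trans
        (Nat.choose_mul_factorial_mul_factorial hj))))
    omega
  simpa [c, hchoose] using hc

/-- The claim amounts to $r\le q(d-2)$, which follows from $r\le d-1$ when $q\ge2$ and $d\ge3$; for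
$q=1$ or $d=2$ the evenness of $2n$ is needed. -/
theorem Nat.div_add_mod_le_of_lt {n d : ℕ} (hd : 2 ≤ d) (hdn : d ≤ 2 * n) :
    2 * n / d + 2 * n % d ≤ n := by
  have h1 := Nat.div_add_mod (2 * n) d
  have h2 := Nat.mod_lt (2 * n) (by omega : d > 0)
  have h3 := Nat.div_pos hdn (by omega)
  generalize 2 * n / d = q at *
  generalize 2 * n % d = r at *
  obtain rfl | hq := (show 1 ≤ q from h3).eq_or_lt
  · omega
  obtain rfl | hd := hd.eq_or_lt
  · omega
  obtain ⟨a, rfl⟩ := Nat.exists_eq_add_of_lt hd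
  obtain ⟨b, rfl⟩ := Nat.exists_eq_add_of_lt hq
  nlinarith [Nat.zero_le (a * b)]

open Polynomial Finset in
theorem ZMod.exists_eq_affine_of_injective_sub {p : ℕ} [Fact p.Prime] (hp : 3 ≤ p)
    {f : ZMod p → ZMod p} {M : Finset (ZMod p)}
    (hM : ∀ m ∈ M, Function.Injective fun x => f x - m * x) (hcard : (p - 1) / 2 ≤ #M) :
    ∃ a b, ∀ x, f x = a * x + b := by
  obtain ⟨n, hn⟩ := (Fact.out : p.Prime).odd_of_ne_two (by omega)
  let P : (ZMod p)[X] := Lagrange.interpolate univ id f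
  have hPf (x : ZMod p) : P.eval x = f x :=
    Lagrange.eval_interpolate_at_node (v := id) f (Set.injOn_id _) (mem_univ x)
  have hPdeg : P.natDegree ≤ p - 1 := by
    have h : P.degree < #(univ : Finset (ZMod p)) :=
      Lagrange.degree_interpolate_lt (v := id) f (Set.injOn_id _)
    rw [card_univ, ZMod.card] at h
    exact natDegree_le_iff_coeff_eq_zero.2 fun N hN =>
      coeff_eq_zero_of_degree_lt (h.trans_le (by exact_mod_cast (by omega : p ≤ N)))
  obtain hd | hd := Nat.lt_or_ge P.natDegree 2
  · obtain ⟨a, b, hab⟩ := exists_eq_X_add_C_of_natDegree_le_one (Nat.le_of_lt_succ hd)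
    exact ⟨a, b, fun x => by rw [← hPf, hab]; simp⟩
  exfalso
  have hp2 : p - 1 = 2 * n := by omega
  have hle := Nat.div_add_mod_le_of_lt (n := n) hd (by omega)
  have hdm := Nat.div_add_mod (2 * n) P.natDegree
  generalize 2 * n / P.natDegree = q at *
  generalize 2 * n % P.natDegree = r at *
  have hP0 : P ≠ 0 := by rintro h; simp [h] at hd
  have hdeg : (X ^ r * P ^ q).natDegree = p - 1 := by
    rw [natDegree_mul (by simp) (pow_ne_zero _ hP0), natDegree_X_pow, natDegree_pow, hp2, ← hdm]
    ring
  have hsum := ZMod.sum_eval_eq_neg_coeff (X ^ r * P ^ q) hdeg.le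
  have hmom := ZMod.moment_eq_zero hM (k := q + r) (by omega) (by omega) (j := r) (by omega)
  simp only [eval_mul, eval_pow, eval_X, hPf] at hsum
  rw [Nat.add_sub_cancel] at hmom
  rw [hmom, ← hdeg, coeff_natDegree, leadingCoeff_mul, leadingCoeff_pow, leadingCoeff_pow] at hsum
  simp [hP0] at hsum

/-! ### Directions and linear coordinates -/

namespace FinitePlane

variable {p : ℕ} [Fact p.Prime]

/-- The pencil of all lines with direction vector `v`. -/
def pencil (v : Plane p) : Set (AffineSubspace (ZMod p) (Plane p)) :=
  {l | IsLine l ∧ l.direction = Submodule.span (ZMod p) {v}}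

theorem isLine_mk' (z : Plane p) {v : Plane p} (hv : v ≠ 0) :
    IsLine (AffineSubspace.mk' z (Submodule.span (ZMod p) {v})) :=
  ⟨AffineSubspace.mk'_nonempty _ _, by
    rw [AffineSubspace.direction_mk', finrank_span_singleton hv]⟩

theorem mk'_mem_pencil (z : Plane p) {v : Plane p} (hv : v ≠ 0) :
    AffineSubspace.mk' z (Submodule.span (ZMod p) {v}) ∈ pencil v :=
  ⟨isLine_mk' z hv, AffineSubspace.direction_mk' _ _⟩

theorem isDirection_iff {d : Set (AffineSubspace (ZMod p) (Plane p))} :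
    IsDirection d ↔ ∃ v ≠ 0, d = pencil v := by
  have key {l : AffineSubspace (ZMod p) (Plane p)} (hl : IsLine l) {v : Plane p}
      (h : l.direction = Submodule.span (ZMod p) {v}) :
      {m | IsLine m ∧ m.Parallel l} = pencil v := by
    ext m
    refine and_congr_right fun hm => ?_
    rw [AffineSubspace.parallel_iff_direction_eq_and_eq_bot_iff_eq_bot, h]
    refine and_iff_left ?_
    have h1 := (AffineSubspace.nonempty_iff_ne_bot m).1 hm.1
    have h2 := (AffineSubspace.nonempty_iff_ne_bot l).1 hl.1
    tauto
  constructor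
  · rintro ⟨l, hl, rfl⟩
    obtain ⟨v, hv, hspan⟩ := finrank_eq_one_iff'.1 hl.2
    refine ⟨v, by simpa using hv, key hl (le_antisymm ?_ ?_)⟩
    · intro w hw
      obtain ⟨c, hc⟩ := hspan ⟨w, hw⟩
      exact Submodule.mem_span_singleton.2 ⟨c, congrArg Subtype.val hc⟩
    · simp
  · rintro ⟨v, hv, rfl⟩
    exact ⟨_, isLine_mk' 0 hv, (key (isLine_mk' 0 hv) (AffineSubspace.direction_mk' _ _)).symm⟩

theorem span_eq_of_pencil_eq {v w : Plane p} (hv : v ≠ 0) (h : pencil v = pencil w) :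
    Submodule.span (ZMod p) {v} = Submodule.span (ZMod p) {w} := by
  have h1 := mk'_mem_pencil 0 hv
  rw [h] at h1
  rw [← h1.2, AffineSubspace.direction_mk']

theorem mem_line_iff {v : Plane p} {χ : Plane p →ₗ[ZMod p] ZMod p}
    (hχ : ∀ z, χ z = 0 ↔ z ∈ Submodule.span (ZMod p) {v})
    {l : AffineSubspace (ZMod p) (Plane p)} (hl : l ∈ pencil v) {x : Plane p} (hx : x ∈ l)
    (z : Plane p) : z ∈ l ↔ χ z = χ x := by
  rw [← AffineSubspace.vsub_right_mem_direction_iff_mem hx, hl.2, vsub_eq_sub, ← hχ, map_sub,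
    sub_eq_zero]

theorem determines_pencil_iff {v : Plane p} (hv : v ≠ 0) {χ : Plane p →ₗ[ZMod p] ZMod p}
    (hχ : ∀ z, χ z = 0 ↔ z ∈ Submodule.span (ZMod p) {v}) {S : Set (Plane p)} :
    Determines S (pencil v) ↔ ¬ Set.InjOn χ S := by
  constructor
  · rintro ⟨l, hl, x, hx, y, hy, hne, hxl, hyl⟩ hinj
    exact hne (hinj hx hy ((mem_line_iff hχ hl hyl x).1 hxl))
  · intro h
    simp only [Set.InjOn, not_forall] at h
    obtain ⟨x, hx, y, hy, hxy, hne⟩ := h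
    have hl := mk'_mem_pencil y hv
    have hy' := AffineSubspace.self_mem_mk' y (Submodule.span (ZMod p) {v})
    exact ⟨_, hl, x, hx, y, hy, hne, (mem_line_iff hχ hl hy' x).2 hxy, hy'⟩

/-- Linear coordinates `φ`, `ψ` of the plane with respect to a basis `e`, `v`. -/
structure IsFrame (e v : Plane p) (φ ψ : Plane p →ₗ[ZMod p] ZMod p) : Prop where
  fst_left : φ e = 1
  fst_right : φ v = 0
  snd_left : ψ e = 0
  snd_right : ψ v = 1
  eq_add (z : Plane p) : z = φ z • e + ψ z • v

theorem exists_isFrame {v : Plane p} (hv : v ≠ 0) : ∃ e φ ψ, IsFrame e v φ ψ := by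
  -- With $\det(v,e)=1$, Cramer's rule gives the coordinates $\varphi=\det(v,\cdot)$ and
  -- $\psi=\det(\cdot,e)$.
  obtain ⟨e, he⟩ : ∃ e : Plane p, v 0 * e 1 - v 1 * e 0 = 1 := by
    by_cases h0 : v 0 = 0
    · have h1 : v 1 ≠ 0 := fun h1 => hv (by ext i; fin_cases i <;> simp [h0, h1])
      exact ⟨![-(v 1)⁻¹, 0], by simp [h1]⟩
    · exact ⟨![0, (v 0)⁻¹], by simp [h0]⟩
  refine ⟨e, v 0 • LinearMap.proj 1 - v 1 • LinearMap.proj 0,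
    e 1 • LinearMap.proj 0 - e 0 • LinearMap.proj 1, ?_, ?_, ?_, ?_, ?_⟩
  · simpa using he
  · simp [mul_comm]
  · simp [mul_comm]
  · simpa [mul_comm] using he
  · intro z
    ext i
    fin_cases i
    · simp; linear_combination (-z 0) * he
    · simp; linear_combination (-z 1) * he

namespace IsFrame

variable {e v : Plane p} {φ ψ : Plane p →ₗ[ZMod p] ZMod p}

theorem right_ne_zero (h : IsFrame e v φ ψ) : v ≠ 0 := by
  rintro rfl
  simpa using h.snd_right

theorem add_smul_ne_zero (h : IsFrame e v φ ψ) (m : ZMod p) : e + m • v ≠ 0 := by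
  intro h0
  simpa [h.fst_left, h.fst_right] using congrArg φ h0

theorem fst_eq_zero_iff (h : IsFrame e v φ ψ) (z : Plane p) :
    φ z = 0 ↔ z ∈ Submodule.span (ZMod p) {v} := by
  rw [Submodule.mem_span_singleton]
  constructor
  · intro hz
    refine ⟨ψ z, ?_⟩
    conv_rhs => rw [h.eq_add z, hz, zero_smul, zero_add]
  · rintro ⟨a, rfl⟩
    simp [h.fst_right]

theorem snd_sub_eq_zero_iff (h : IsFrame e v φ ψ) (m : ZMod p) (z : Plane p) :
    (ψ - m • φ) z = 0 ↔ z ∈ Submodule.span (ZMod p) {e + m • v} := by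
  rw [Submodule.mem_span_singleton]
  constructor
  · intro hz
    have hz' : ψ z = m * φ z := by simpa [sub_eq_zero] using hz
    refine ⟨φ z, ?_⟩
    conv_rhs => rw [h.eq_add z, hz']
    rw [smul_add, smul_smul, mul_comm]
  · rintro ⟨a, rfl⟩
    simp [h.fst_left, h.fst_right, h.snd_left, h.snd_right, mul_comm]

theorem pencil_eq (h : IsFrame e v φ ψ) {w : Plane p} (hw : w ≠ 0) :
    pencil w = pencil v ∨ ∃ m : ZMod p, pencil w = pencil (e + m • v) := by
  have key {a : ZMod p} {u : Plane p} (hu : w = a • u) :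
      pencil w = pencil u := by
    have ha : a ≠ 0 := by rintro rfl; simp [hu] at hw
    rw [pencil, hu, Submodule.span_singleton_smul_eq ha.isUnit, pencil]
  by_cases h0 : φ w = 0
  · refine .inl (key (a := ψ w) ?_)
    conv_lhs => rw [h.eq_add w, h0, zero_smul, zero_add]
  · refine .inr ⟨ψ w / φ w, key (a := φ w) ?_⟩
    conv_lhs => rw [h.eq_add w]
    rw [smul_add, smul_smul, mul_div_cancel₀ _ h0]

theorem setOf_isDirection (h : IsFrame e v φ ψ) :
    {d | IsDirection d} = insert (pencil v) (Set.range fun m : ZMod p => pencil (e + m • v)) := by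
  ext d
  simp only [Set.mem_ofPred_eq, isDirection_iff, Set.mem_insert_iff, Set.mem_range]
  constructor
  · rintro ⟨w, hw, rfl⟩
    obtain h1 | ⟨m, h1⟩ := h.pencil_eq hw
    exacts [.inl h1, .inr ⟨m, h1.symm⟩]
  · rintro (rfl | ⟨m, rfl⟩)
    exacts [⟨v, h.right_ne_zero, rfl⟩, ⟨_, h.add_smul_ne_zero m, rfl⟩]

theorem pencil_add_smul_injective (h : IsFrame e v φ ψ) :
    Function.Injective fun m : ZMod p => pencil (e + m • v) := by
  intro m m' hm
  have h1 := span_eq_of_pencil_eq (h.add_smul_ne_zero m) hm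
  have h2 := (h.snd_sub_eq_zero_iff m' (e + m • v)).2 (h1 ▸ Submodule.mem_span_singleton_self _)
  simpa [h.fst_left, h.fst_right, h.snd_left, h.snd_right, sub_eq_zero] using h2

theorem pencil_ne (h : IsFrame e v φ ψ) (m : ZMod p) : pencil (e + m • v) ≠ pencil v := by
  intro hm
  have h1 := span_eq_of_pencil_eq (h.add_smul_ne_zero m) hm
  have h2 := (h.fst_eq_zero_iff (e + m • v)).2 (h1 ▸ Submodule.mem_span_singleton_self _)
  simp [h.fst_left, h.fst_right] at h2

end IsFrame

theorem ncard_setOf_isDirection :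
    {d : Set (AffineSubspace (ZMod p) (Plane p)) | IsDirection d}.ncard = p + 1 := by
  obtain ⟨e, φ, ψ, h⟩ := exists_isFrame (one_ne_zero : (1 : Plane p) ≠ 0)
  rw [h.setOf_isDirection, Set.ncard_insert_of_notMem, ← Set.image_univ,
    Set.ncard_image_of_injective _ h.pencil_add_smul_injective, Set.ncard_univ, Nat.card_zmod]
  rintro ⟨m, hm⟩
  exact h.pencil_ne m hm

/-! ### Sets of $p$ points -/

theorem bijOn_of_injOn {S : Set (Plane p)} (hS : S.ncard = p) {χ : Plane p → ZMod p}
    (hχ : Set.InjOn χ S) : Set.BijOn χ S Set.univ := by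
  refine ⟨Set.mapsTo_univ _ _, hχ, ?_⟩
  rw [Set.SurjOn, Set.eq_of_subset_of_ncard_le (Set.subset_univ (χ '' S))]
  rw [hχ.ncard_image, hS, Set.ncard_univ, Nat.card_zmod]

theorem isPerfect_of_not_determines {S : Set (Plane p)} (hS : S.ncard = p)
    {d : Set (AffineSubspace (ZMod p) (Plane p))} (hd : IsDirection d) (hdet : ¬ Determines S d) :
    IsPerfect (S.indicator fun _ => (1 : ℝ)) d := by
  classical
  obtain ⟨v, hv, rfl⟩ := isDirection_iff.1 hd
  obtain ⟨e, φ, ψ, h⟩ := exists_isFrame hv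
  rw [determines_pencil_iff hv h.fst_eq_zero_iff, not_not] at hdet
  have hbij := bijOn_of_injOn hS hdet
  have hsum (T : Set (Plane p)) : ∑ z, T.indicator (fun _ => (1 : ℝ)) z = T.ncard := by
    simp [Set.indicator_apply, Set.ncard_eq_toFinset_card']
  intro l hl
  obtain ⟨x, hx⟩ := hl.1.1
  obtain ⟨s, hs, hsx⟩ := hbij.surjOn (Set.mem_univ (φ x))
  have hls : (l : Set (Plane p)) ∩ S = {s} := by
    ext z
    simp only [Set.mem_inter_iff, SetLike.mem_coe, Set.mem_singleton_iff,
      mem_line_iff h.fst_eq_zero_iff hl hx z, ← hsx]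
    exact ⟨fun hz => hdet hz.2 hs hz.1, by rintro rfl; exact ⟨rfl, hs⟩⟩
  have hp : (p : ℝ) ≠ 0 := by exact_mod_cast (Fact.out : p.Prime).ne_zero
  rw [Set.indicator_indicator, hls, hsum, hsum, hS, Set.ncard_singleton]
  field_simp
  simp

/-- The Rédei–Megyesi theorem. -/
theorem exists_isLine_of_lt_ncard_not_determines (hp : 3 ≤ p) {S : Set (Plane p)}
    (hS : S.ncard = p)
    (hcard : (p - 1) / 2 < {d | IsDirection d ∧ ¬ Determines S d}.ncard) :
    ∃ l : AffineSubspace (ZMod p) (Plane p), IsLine l ∧ (l : Set (Plane p)) = S := by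
  classical
  obtain ⟨d, hd, hdet⟩ := Set.nonempty_of_ncard_ne_zero (Nat.ne_zero_of_lt hcard)
  obtain ⟨v, hv, rfl⟩ := isDirection_iff.1 hd
  obtain ⟨e, φ, ψ, h⟩ := exists_isFrame hv
  let M : Finset (ZMod p) := {m | ¬ Determines S (pencil (e + m • v))}
  -- The vertical direction has no slope, so one undetermined direction is lost; the strict bound
  -- `hcard` absorbs this.
  have hM : (p - 1) / 2 ≤ M.card := by
    have hsub : {d | IsDirection d ∧ ¬ Determines S d} ⊆
        (insert (pencil v) (M.image fun m => pencil (e + m • v)) : Finset _) := by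
      rintro d ⟨hd, hnd⟩
      have hd' : d ∈ {d | IsDirection d} := hd
      rw [h.setOf_isDirection] at hd'
      obtain rfl | ⟨m, rfl⟩ := hd'
      · simp
      · exact Finset.mem_insert_of_mem
          (Finset.mem_image_of_mem _ (Finset.mem_filter.2 ⟨Finset.mem_univ _, hnd⟩))
    have h1 := Set.ncard_le_ncard hsub (Finset.finite_toSet _)
    rw [Set.ncard_coe_finset] at h1
    have h2 := Finset.card_insert_le (pencil v) (M.image fun m => pencil (e + m • v))
    have h3 := Finset.card_image_le (s := M) (f := fun m => pencil (e + m • v))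
    omega
  rw [determines_pencil_iff hv h.fst_eq_zero_iff, not_not] at hdet
  have hbij := bijOn_of_injOn hS hdet
  choose s hs hsφ using fun x => hbij.surjOn (Set.mem_univ x)
  have hinj : ∀ m ∈ M, Function.Injective fun x => ψ (s x) - m * x := by
    intro m hm x y hxy
    have hm' := (Finset.mem_filter.1 hm).2
    rw [determines_pencil_iff (h.add_smul_ne_zero m) (h.snd_sub_eq_zero_iff m), not_not] at hm'
    have := hm' (hs x) (hs y) (by simpa [hsφ] using hxy)
    rw [← hsφ x, this, hsφ]
  obtain ⟨a, b, hab⟩ := ZMod.exists_eq_affine_of_injective_sub hp hinj hM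
  have hl := mk'_mem_pencil (s 0) (h.add_smul_ne_zero a)
  refine ⟨_, hl.1, ?_⟩
  ext z
  rw [SetLike.mem_coe, mem_line_iff (h.snd_sub_eq_zero_iff a) hl (AffineSubspace.self_mem_mk' _ _)]
  have hz : (ψ - a • φ) z = (ψ - a • φ) (s 0) ↔ ψ z = ψ (s (φ z)) := by
    simp only [LinearMap.sub_apply, LinearMap.smul_apply, smul_eq_mul, hsφ, hab, mul_zero,
      zero_add, sub_zero, sub_eq_iff_eq_add, add_comm b]
  rw [hz]
  constructor
  · intro hψ
    have : z = s (φ z) := by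
      rw [h.eq_add z, hψ]
      conv_rhs => rw [h.eq_add (s _)]
      simp [hsφ, h.fst_left, h.fst_right]
    exact this ▸ hs _
  · intro hzS
    rw [hdet (hs (φ z)) hzS (hsφ _)]

end FinitePlane

theorem mainTheorem2 (p : ℕ) [Fact p.Prime] (hp : 3 ≤ p)
    (S : Set (FinitePlane.Plane p)) (hS : S.ncard = p) :
    (∀ d, FinitePlane.IsDirection d → ¬ FinitePlane.Determines S d →
      FinitePlane.IsPerfect (S.indicator fun _ => (1 : ℝ)) d) ∧
    ((¬ ∃ l : AffineSubspace (ZMod p) (FinitePlane.Plane p),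
        FinitePlane.IsLine l ∧ (l : Set (FinitePlane.Plane p)) = S) →
      ({d | FinitePlane.IsDirection d ∧ ¬ FinitePlane.Determines S d}.ncard : ℝ)
          ≤ ((p : ℝ) - 1) / 2 ∧
      ((p : ℝ) + 3) / 2
          ≤ ({d | FinitePlane.IsDirection d ∧ FinitePlane.Determines S d}.ncard : ℝ)) := by
  refine ⟨fun d hd hdet => FinitePlane.isPerfect_of_not_determines hS hd hdet, fun hline => ?_⟩
  have hN := not_lt.1 fun hlt =>
    hline (FinitePlane.exists_isLine_of_lt_ncard_not_determines hp hS hlt)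
  have hfin : {d : Set (AffineSubspace (ZMod p) (FinitePlane.Plane p)) |
      FinitePlane.IsDirection d}.Finite :=
    Set.finite_of_ncard_pos (by rw [FinitePlane.ncard_setOf_isDirection]; omega)
  have hsplit : {d | FinitePlane.IsDirection d ∧ FinitePlane.Determines S d}.ncard
      + {d | FinitePlane.IsDirection d ∧ ¬ FinitePlane.Determines S d}.ncard = p + 1 := by
    rw [← FinitePlane.ncard_setOf_isDirection (p := p)]
    exact Set.ncard_inter_add_ncard_sdiff_eq_ncard _ {d | FinitePlane.Determines S d} hfin
  rw [le_div_iff₀ two_pos, div_le_iff₀ two_pos, le_sub_iff_add_le]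
  norm_cast
  omega
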